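/- Let $s>0$. There exist constants $C_1, C_2, C_3, C_4 > 0$ depending only on $s$ such that the following holds. Let $L, d$ be integers and $u$ a real number with \[ L \geq C_1 , \qquad d \geq C_2 , \qquad u \in [C_3, C_4 L^{1/4}] , \] and let $N_1, \dots, N_L$ be random $d \times d$ real matrices whose $Ld^2$ entries are independent standard Gaussian $\mathcal{N}(0,1)$ variables. Then, with probability at least \[ 1 - 8 \exp\Big(-\frac{d u^2}{32 s^2}\Big) , \] it holds simultaneously for all families $\theta = (\theta_1, \dots, \theta_L)$ of $d \times d$ real matrices with $\max_{1 \leq k \leq L} \|\theta_k\|_2 \leq \frac{1}{64} \exp(-2s^2 - 4u)$ and all $k \in \{1, \dots, L\}$ that \[ \Big\| \Big(I + \frac{s}{\sqrt{Ld}} N_k + \frac{1}{L}\theta_k\Big) \cdots \Big(I + \frac{s}{\sqrt{Ld}} N_1 + \frac{1}{L}\theta_1\Big) \Big\|_2 \leq 4 \exp\Big(\frac{s^2}{2} + u\Big) \] and \[ \sigma_{\min}\Big( \Big(I + \frac{s}{\sqrt{Ld}} N_k + \frac{1}{L}\theta_k\Big) \cdots \Big(I + \frac{s}{\sqrt{Ld}}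 N_1 + \frac{1}{L}\theta_1\Big) \Big) \geq \frac{1}{4} \exp\Big(-\frac{2s^2}{d} - u\Big) . \] Here $\|\cdot\|_2$ denotes the $\ell_2$ operator norm of a matrix and $\sigma_{\min}$ its smallest singular value. -/

import Mathlib

open MeasureTheory ProbabilityTheory

noncomputable section

/-- The `ℓ²` operator norm `‖A‖₂` of a real square matrix. -/
def opNorm {d : ℕ} (A : Matrix (Fin d) (Fin d) ℝ) : ℝ :=
  ‖Matrix.toEuclideanCLM (n := Fin d) (𝕜 := ℝ) A‖

/-- The smallest singular value of a real `d × d` matrix, `d ≥ 1`: its singular values are listed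
in decreasing order with indices `0, …, d - 1`, and this is the last one. -/
def sigmaMin {d : ℕ} (A : Matrix (Fin d) (Fin d) ℝ) : ℝ :=
  (Matrix.toEuclideanLin A).singularValues (d - 1)

/-- The ordered product `W_k ⋯ W_1` of the first `k` matrices of the family `W_1, …, W_L`
(`W_j` is `W` at the `j`-th element of `Fin L`); it is the identity for `k = 0`. -/
def partialProduct {L d : ℕ} (W : Fin L → Matrix (Fin d) (Fin d) ℝ) (k : Fin (L + 1)) :
    Matrix (Fin d) (Fin d) ℝ :=
  Fin.induction (motive := fun _ => Matrix (Fin d) (Fin d) ℝ) 1 (fun j A => W j * A) k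

/-- The residual weight matrices `I + s / √(L d) N_k + θ_k / L`. -/
def residualWeight {L d : ℕ} (s : ℝ) (N θ : Fin L → Matrix (Fin d) (Fin d) ℝ) (k : Fin L) :
    Matrix (Fin d) (Fin d) ℝ :=
  1 + (s / √((L : ℝ) * (d : ℝ))) • N k + (1 / (L : ℝ)) • θ k

/-- The random matrices `N_1, …, N_L` are filled with i.i.d. standard Gaussian entries: all the
`L d²` entries are jointly independent with law `𝒩(0, 1)`. -/
structure IsIIDStdGaussian {Ω : Type*} [MeasurableSpace Ω] (P : Measure Ω) {L d : ℕ}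
    (N : Fin L → Ω → Matrix (Fin d) (Fin d) ℝ) : Prop where
  hasLaw : ∀ (k : Fin L) (i j : Fin d), HasLaw (fun ω => N k ω i j) (gaussianReal 0 1) P
  indep : iIndepFun (fun (p : Fin L × Fin d × Fin d) (ω : Ω) => N p.1 ω p.2.1 p.2.2) P

end

/-!
The unperturbed products are controlled first, with `θ = 0`. Write `τ = s / √(L d)`, and let `w` be
a unit vector. For a Gaussian matrix `M` the vector `M w` is standard Gaussian, so the moments of
`‖(I + τ M) w‖` are explicit: its `p`-th moment is at most about `exp (p s² / (2 L) + p² s² / (L d))`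
(`lintegral_enorm_residualStep_le`). Its `(-p)`-th moment is infinite for `p ≥ d`, but it is finite
and of the expected size once the step is truncated on the event `1 + τ ⟪w, M w⟫ < 1 / 2`, whose
probability `exp (-L d / (8 s²))` is negligible because `u² ≤ √L`
(`lintegral_min_enorm_inv_residualStep_le`).

Because the bound for a step scales with the vector it acts on, conditioning on the first factor and
inducting on the number of factors gives a maximal inequality with no loss in `L`
(`measure_hitsWithin_le`). With `p = d u / (2 s²)` it shows that, for fixed `w`, all partial products
satisfy `exp (-2 s² / d - u) ≤ ‖P_k w‖ ≤ exp (s² / 2 + u)` except with probability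
`3 exp (-d u² / (8 s²))`. A union bound over a net of the sphere with mesh `exp (-O(s² + u))` costs a
factor `exp (6 d u)`, which the gap between `8` and `32` in the exponents absorbs as soon as
`u ≥ 1 + 64 s²`; the net then yields both bounds for all vectors, up to a factor `2`.

What remains is deterministic. If `P_k` and `P'_k` are the products without and with the `θ_j`, then
`P'_k = P_k Q_k` with `Q_k = Q_{k-1} + P_k⁻¹ (θ_k / L) P_{k-1} Q_{k-1}`. The size allowed for `θ` makes
each increment at most `‖Q_{k-1}‖ / (16 L)`, so `Q_k` stays within `1 / 2` of the identity for all `k`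
and all `θ` simultaneously (`partialProduct_add_bounds`), which costs another factor `2`.
-/

noncomputable section

open scoped ENNReal

/-! ### Gaussian integrals -/

lemma exp_sub_sq_le {t : ℝ} (ht : -(1 / 2) ≤ t) : Real.exp (t - t ^ 2) ≤ 1 + t := by
  -- it is enough to bound `exp (t ^ 2 - t)` below by some `D` with `1 ≤ D * (1 + t)`; the first-order
  -- Taylor polynomial serves for `t ≥ 0`, the second-order one for `t ≤ 0`
  have hinv : ∀ {D : ℝ}, D ≤ Real.exp (t ^ 2 - t) → 0 < D → 1 ≤ D * (1 + t) →
      Real.exp (t - t ^ 2) ≤ 1 + t := by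
    intro D hD hD0 h
    have h1 : Real.exp (t - t ^ 2) * Real.exp (t ^ 2 - t) = 1 := by
      rw [← Real.exp_add]; simp
    have h2 : 0 < 1 + t := by linarith
    have h3 := Real.exp_pos (t - t ^ 2)
    nlinarith [mul_le_mul_of_nonneg_left hD h3.le]
  rcases le_total 0 t with h0 | h0
  · refine hinv (Real.add_one_le_exp _) (by nlinarith [sq_nonneg (t - 1)]) ?_
    have : (t ^ 2 - t + 1) * (1 + t) = 1 + t ^ 3 := by ring
    rw [this]
    linarith [pow_nonneg h0 3]
  · have hx : 0 ≤ t ^ 2 - t := by nlinarith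
    refine hinv (Real.quadratic_le_exp_of_nonneg hx) (by positivity) ?_
    have e : (1 + (t ^ 2 - t) + (t ^ 2 - t) ^ 2 / 2) * (1 + t)
        = 1 + t ^ 2 * (t + (1 - t) ^ 2 * (1 + t) / 2) := by ring
    have h4 : 0 ≤ t + (1 - t) ^ 2 * (1 + t) / 2 := by
      have : t + (1 - t) ^ 2 * (1 + t) / 2 = (1 + t - t ^ 2 + t ^ 3) / 2 := by ring
      rw [this]
      nlinarith [mul_nonneg (sq_nonneg t) (by linarith : 0 ≤ 1/2 + t)]
    rw [e]
    nlinarith [mul_nonneg (sq_nonneg t) h4]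

lemma lintegral_exp_gaussianReal (a : ℝ) {b : ℝ} (hb : b < 1 / 2) :
    ∫⁻ x, ENNReal.ofReal (Real.exp (a * x + b * x ^ 2)) ∂(gaussianReal 0 1)
      = ENNReal.ofReal ((√(1 - 2 * b))⁻¹ * Real.exp (a ^ 2 / (2 * (1 - 2 * b)))) := by
  have hc : 0 < 1 - 2 * b := by linarith
  set v : NNReal := ⟨(1 - 2 * b)⁻¹, by positivity⟩ with hv
  have hvr : (v : ℝ) = (1 - 2 * b)⁻¹ := rfl
  have hv0 : v ≠ 0 := by
    intro h
    have : (v : ℝ) = 0 := by rw [h]; rfl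
    rw [hvr] at this
    exact (inv_pos.2 hc).ne' this
  rw [gaussianReal_of_var_ne_zero 0 one_ne_zero, lintegral_withDensity_eq_lintegral_mul _
    (measurable_gaussianPDF 0 1) (by fun_prop)]
  -- completing the square turns the integrand into a multiple of another Gaussian density
  have key : ∀ x : ℝ, (gaussianPDF 0 1 * fun x ↦ ENNReal.ofReal (Real.exp (a * x + b * x ^ 2))) x
      = ENNReal.ofReal ((√(1 - 2 * b))⁻¹ * Real.exp (a ^ 2 / (2 * (1 - 2 * b))))
        * gaussianPDF (a * v) v x := by
    intro x
    simp only [Pi.mul_apply, gaussianPDF]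
    rw [← ENNReal.ofReal_mul (gaussianPDFReal_nonneg _ _ _), ← ENNReal.ofReal_mul (by positivity)]
    congr 1
    simp only [gaussianPDFReal, hvr]
    have hs : √(2 * Real.pi * (1 - 2 * b)⁻¹) = √(2 * Real.pi) * (√(1 - 2 * b))⁻¹ := by
      rw [Real.sqrt_mul (by positivity), Real.sqrt_inv]
    have hs0 : √(1 - 2 * b) ≠ 0 := by positivity
    have hp0 : √(2 * Real.pi) ≠ 0 := by positivity
    rw [hs]
    have e1 : Real.exp (-(x - 0) ^ 2 / (2 * ((1 : NNReal) : ℝ))) * Real.exp (a * x + b * x ^ 2)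
        = Real.exp (a ^ 2 / (2 * (1 - 2 * b))) *
          Real.exp (-(x - a * (1 - 2 * b)⁻¹) ^ 2 / (2 * (1 - 2 * b)⁻¹)) := by
      rw [← Real.exp_add, ← Real.exp_add]
      congr 1
      simp only [NNReal.coe_one]
      field_simp
      ring
    simp only [NNReal.coe_one, mul_one] at e1 ⊢
    rw [mul_assoc, e1]
    field_simp
  rw [lintegral_congr key, lintegral_const_mul _ (measurable_gaussianPDF _ _),
    lintegral_gaussianPDF_eq_one _ hv0, mul_one]

/-- An upper bound with the square-root factor absorbed into the exponent. -/
lemma lintegral_exp_gaussianReal_le (a : ℝ) {b : ℝ} (hb : b ≤ 1 / 4) :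
    ∫⁻ x, ENNReal.ofReal (Real.exp (a * x + b * x ^ 2)) ∂(gaussianReal 0 1)
      ≤ ENNReal.ofReal (Real.exp (a ^ 2 + (b + 2 * b ^ 2))) := by
  rw [lintegral_exp_gaussianReal a (by linarith), Real.exp_add, mul_comm]
  have hc : 0 < 1 - 2 * b := by linarith
  gcongr
  · rw [div_le_iff₀ (by positivity)]
    nlinarith [sq_nonneg a]
  · rw [inv_le_comm₀ (by positivity) (Real.exp_pos _), ← Real.exp_neg]
    apply Real.le_sqrt_of_sq_le
    rw [← Real.exp_nat_mul]
    have := exp_sub_sq_le (t := -(2 * b)) (by linarith)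
    refine le_trans (le_of_eq ?_) (this.trans (le_of_eq (by ring)))
    congr 1
    push_cast
    ring

lemma lintegral_exp_stdGaussian_le {ι : Type*} [Fintype ι] (a : EuclideanSpace ℝ ι) {b : ℝ}
    (hb : b ≤ 1 / 4) :
    ∫⁻ g, ENNReal.ofReal (Real.exp (inner ℝ a g + b * ‖g‖ ^ 2))
        ∂(stdGaussian (EuclideanSpace ℝ ι))
      ≤ ENNReal.ofReal (Real.exp (‖a‖ ^ 2 + Fintype.card ι * (b + 2 * b ^ 2))) := by
  rw [← map_pi_eq_stdGaussian, lintegral_map (by fun_prop) (by fun_prop)]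
  have key : ∀ x : ι → ℝ, ENNReal.ofReal (Real.exp (inner ℝ a (WithLp.toLp 2 x)
      + b * ‖(WithLp.toLp 2 x : EuclideanSpace ℝ ι)‖ ^ 2))
      = ∏ i, ENNReal.ofReal (Real.exp (a i * x i + b * x i ^ 2)) := by
    intro x
    rw [← ENNReal.ofReal_prod_of_nonneg (fun _ _ => (Real.exp_pos _).le), ← Real.exp_sum,
      EuclideanSpace.norm_sq_eq, PiLp.inner_apply, Finset.mul_sum, ← Finset.sum_add_distrib]
    congr 2
    refine Finset.sum_congr rfl fun i _ => ?_
    simp [mul_comm]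
  rw [lintegral_congr key, lintegral_prod_eq_prod_lintegral_of_indepFun Finset.univ
    (fun i (x : ι → ℝ) => ENNReal.ofReal (Real.exp (a i * x i + b * x i ^ 2)))
    (iIndepFun_pi (X := fun i x => ENNReal.ofReal (Real.exp (a i * x + b * x ^ 2)))
      (fun i => by fun_prop)) (fun i => by fun_prop)]
  calc _ ≤ ∏ i, ENNReal.ofReal (Real.exp (a i ^ 2 + (b + 2 * b ^ 2))) := by
        gcongr with i
        rw [← lintegral_map (μ := Measure.pi fun _ : ι => gaussianReal 0 1)
          (f := fun x => ENNReal.ofReal (Real.exp (a i * x + b * x ^ 2))) (g := fun x => x i)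
          (by fun_prop) (by fun_prop), (measurePreserving_eval _ i).map_eq]
        exact lintegral_exp_gaussianReal_le _ hb
    _ = _ := by
        rw [← ENNReal.ofReal_prod_of_nonneg (fun _ _ => (Real.exp_pos _).le), ← Real.exp_sum,
          Finset.sum_add_distrib, EuclideanSpace.norm_sq_eq]
        simp [mul_add]

/-- The inner product of a standard Gaussian vector with a unit vector is a standard normal. -/
lemma map_inner_stdGaussian {E : Type*} [NormedAddCommGroup E] [InnerProductSpace ℝ E]
    [FiniteDimensional ℝ E] [MeasurableSpace E] [BorelSpace E] {w : E} (hw : ‖w‖ = 1) :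
    (stdGaussian E).map (fun g => inner ℝ w g) = gaussianReal 0 1 := by
  have h := IsGaussian.map_eq_gaussianReal (μ := stdGaussian E) (innerSL ℝ w)
  have h1 := integral_strongDual_stdGaussian (innerSL ℝ w)
  rw [h1, variance_dual_stdGaussian, innerSL_apply_norm, hw] at h
  simpa using h

/-- The law of a `d × d` matrix with independent standard Gaussian entries. -/
def gaussianMatrix (d : ℕ) : Measure (Fin d → Fin d → ℝ) :=
  Measure.pi fun _ => Measure.pi fun _ => gaussianReal 0 1

instance (d : ℕ) : IsProbabilityMeasure (gaussianMatrix d) := by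
  unfold gaussianMatrix; infer_instance

/-- A Gaussian matrix maps every unit vector to a standard Gaussian vector: the rows are independent
and each row has a standard normal inner product with the unit vector. -/
lemma map_mulVec_gaussianMatrix {d : ℕ} {w : EuclideanSpace ℝ (Fin d)} (hw : ‖w‖ = 1) :
    (gaussianMatrix d).map (fun M => Matrix.toEuclideanCLM (n := Fin d) (𝕜 := ℝ) (Matrix.of M) w)
      = stdGaussian (EuclideanSpace ℝ (Fin d)) := by
  have hrow : (Measure.pi fun _ : Fin d => gaussianReal 0 1).map (fun r => ∑ j, r j * w j)
      = gaussianReal 0 1 := by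
    have h := map_inner_stdGaussian hw
    rw [← map_pi_eq_stdGaussian, Measure.map_map (by fun_prop) (by fun_prop)] at h
    convert h using 2
    ext r
    simp [PiLp.inner_apply]
  have : (fun M : Fin d → Fin d → ℝ =>
      Matrix.toEuclideanCLM (n := Fin d) (𝕜 := ℝ) (Matrix.of M) w)
      = WithLp.toLp 2 ∘ fun M i => ∑ j, M i j * w j := by
    ext M i
    simp [Matrix.mulVec, dotProduct]
  rw [this, ← Measure.map_map (by fun_prop) (by fun_prop), gaussianMatrix,
    Measure.pi_map_pi (f := fun _ (r : Fin d → ℝ) => ∑ j, r j * w j)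
      (fun i => Measurable.aemeasurable (by fun_prop))]
  simp_rw [hrow]
  exact map_pi_eq_stdGaussian

/-! ### A maximal inequality for random iterations -/

/-- The orbit `y, T x₀ y, T x₁ (T x₀ y), …` of `y` under at most `n` maps `T xᵢ` meets `B`. -/
def HitsWithin {X E : Type*} (T : X → E → E) (B : Set E) : (n : ℕ) → (Fin n → X) → E → Prop
  | 0, _, y => y ∈ B
  | n + 1, x, y => y ∈ B ∨ HitsWithin T B n (Fin.tail x) (T (x 0) y)

lemma measurableSet_hitsWithin {X E : Type*} [MeasurableSpace X] [MeasurableSpace E]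
    {T : X → E → E} (hT : Measurable (Function.uncurry T)) {B : Set E} (hB : MeasurableSet B)
    (n : ℕ) : MeasurableSet {p : (Fin n → X) × E | HitsWithin T B n p.1 p.2} := by
  induction n with
  | zero => exact measurable_snd hB
  | succ n ih =>
    have h1 : Measurable fun p : (Fin (n + 1) → X) × E =>
        ((Fin.tail p.1, T (p.1 0) p.2) : (Fin n → X) × E) := by
      refine Measurable.prodMk ?_ ?_
      · refine measurable_pi_iff.2 fun i => ?_
        exact (measurable_pi_apply i.succ).comp measurable_fst
      · have h0 : Measurable fun p : (Fin (n + 1) → X) × E => (p.1 0, p.2) :=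
          ((measurable_pi_apply 0).comp measurable_fst).prodMk measurable_snd
        exact hT.comp h0
    exact (measurable_snd hB).union (h1 ih)

/-- Maximal inequality for i.i.d. random maps. If one step multiplies `Φ` by at most `m` on average, up
to truncation at `1` and an additive error `q`, then an orbit of length `n` started at `y` reaches
`{Φ ≥ 1}` with probability at most `m ^ n * Φ y + n * q`. -/
theorem measure_hitsWithin_le {X E : Type*} [MeasurableSpace X] [MeasurableSpace E]
    (μ : Measure X) [IsProbabilityMeasure μ] {T : X → E → E}
    (hT : Measurable (Function.uncurry T)) {Φ : E → ℝ≥0∞} (hΦ : Measurable Φ) {m q : ℝ≥0∞}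
    (hm : 1 ≤ m) (h : ∀ c y, ∫⁻ x, min 1 (c * Φ (T x y)) ∂μ ≤ m * (c * Φ y) + q) (n : ℕ) (y : E) :
    Measure.pi (fun _ : Fin n => μ) {x | HitsWithin T {z | 1 ≤ Φ z} n x y}
      ≤ m ^ n * Φ y + n * q := by
  have hB : MeasurableSet {z | 1 ≤ Φ z} := measurableSet_le measurable_const hΦ
  induction n generalizing y with
  | zero =>
    by_cases hy : 1 ≤ Φ y
    · exact prob_le_one.trans (by simpa using hy)
    · have : {x : Fin 0 → X | HitsWithin T {z | 1 ≤ Φ z} 0 x y} = ∅ := by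
        ext x; simpa [HitsWithin] using hy
      rw [this]; simp
  | succ n ih =>
    by_cases hy : 1 ≤ Φ y
    · refine prob_le_one.trans (hy.trans ?_)
      calc Φ y ≤ m ^ (n + 1) * Φ y := le_mul_of_one_le_left' (one_le_pow₀ hm)
        _ ≤ _ := le_self_add
    -- the orbit has not yet reached the target: condition on the first map
    · have hmeas := measurableSet_hitsWithin hT hB n
      have hS : MeasurableSet {p : X × (Fin n → X) |
          HitsWithin T {z | 1 ≤ Φ z} n p.2 (T p.1 y)} := by
        have : Measurable fun p : X × (Fin n → X) => ((p.2, T p.1 y) : (Fin n → X) × E) :=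
          measurable_snd.prodMk (hT.comp (measurable_fst.prodMk measurable_const))
        exact this hmeas
      have hpre : {x : Fin (n + 1) → X | HitsWithin T {z | 1 ≤ Φ z} (n + 1) x y}
          = MeasurableEquiv.piFinSuccAbove (fun _ => X) 0 ⁻¹'
            {p | HitsWithin T {z | 1 ≤ Φ z} n p.2 (T p.1 y)} := by
        ext x
        simp only [HitsWithin, Set.mem_ofPred_eq, hy, false_or, Set.mem_preimage]
        rfl
      rw [hpre, (measurePreserving_piFinSuccAbove (fun _ : Fin (n + 1) => μ) 0).measure_preimage
        hS.nullMeasurableSet, Measure.prod_apply hS]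
      calc _ ≤ ∫⁻ x, (min 1 (m ^ n * Φ (T x y)) + n * q) ∂μ := by
            refine lintegral_mono fun x => ?_
            change Measure.pi (fun _ : Fin n => μ) {z | HitsWithin T _ n z (T x y)} ≤ _
            rw [← min_add_add_right]
            exact le_min (prob_le_one.trans le_self_add) (ih _)
        _ = ∫⁻ x, min 1 (m ^ n * Φ (T x y)) ∂μ + n * q := by
            rw [lintegral_add_right _ measurable_const]; simp
        _ ≤ (m * (m ^ n * Φ y) + q) + n * q := by gcongr; exact h _ _
        _ = _ := by push_cast; ring

/-! ### Moments of one step -/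

/-- One step `y ↦ (I + τ M) y` of the product of random matrices. -/
def residualStep {d : ℕ} (τ : ℝ) (M : Fin d → Fin d → ℝ) (y : EuclideanSpace ℝ (Fin d)) :
    EuclideanSpace ℝ (Fin d) :=
  y + τ • Matrix.toEuclideanCLM (n := Fin d) (𝕜 := ℝ) (Matrix.of M) y

section OneStep

variable {d : ℕ} {τ p : ℝ}

lemma measurable_residualStep : Measurable (Function.uncurry (residualStep (d := d) τ)) := by
  have : Function.uncurry (residualStep (d := d) τ) =
      fun z => z.2 + τ • WithLp.toLp 2 (fun i => ∑ j, z.1 i j * z.2 j) := by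
    ext z i
    simp [Function.uncurry, residualStep, Matrix.mulVec, dotProduct]
  rw [this]
  fun_prop

lemma residualStep_smul (c : ℝ) (M : Fin d → Fin d → ℝ) (y : EuclideanSpace ℝ (Fin d)) :
    residualStep τ M (c • y) = c • residualStep τ M y := by
  simp [residualStep, smul_comm c τ]

lemma enorm_residualStep (M : Fin d → Fin d → ℝ) {y : EuclideanSpace ℝ (Fin d)} (hy : y ≠ 0) :
    ‖residualStep τ M y‖ₑ = ‖y‖ₑ * ‖residualStep τ M (‖y‖⁻¹ • y)‖ₑ := by
  have : y = ‖y‖ • (‖y‖⁻¹ • y) := by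
    rw [smul_smul, mul_inv_cancel₀ (norm_ne_zero_iff.2 hy), one_smul]
  conv_lhs => rw [this, residualStep_smul, enorm_smul, enorm_norm]

lemma lintegral_comp_residualStep {w : EuclideanSpace ℝ (Fin d)} (hw : ‖w‖ = 1)
    {f : EuclideanSpace ℝ (Fin d) → ℝ≥0∞} (hf : Measurable f) :
    ∫⁻ M, f (residualStep τ M w) ∂gaussianMatrix d
      = ∫⁻ g, f (w + τ • g) ∂stdGaussian (EuclideanSpace ℝ (Fin d)) := by
  have hT : Measurable fun M : Fin d → Fin d → ℝ =>
      Matrix.toEuclideanCLM (n := Fin d) (𝕜 := ℝ) (Matrix.of M) w := by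
    have : (fun M : Fin d → Fin d → ℝ =>
      Matrix.toEuclideanCLM (n := Fin d) (𝕜 := ℝ) (Matrix.of M) w)
      = fun M => WithLp.toLp 2 fun i => ∑ j, M i j * w j := by
      ext M i
      simp [Matrix.mulVec, dotProduct]
    rw [this]; fun_prop
  rw [← map_mulVec_gaussianMatrix hw, lintegral_map (by fun_prop) hT]
  rfl

/-- Positive moments of one step. For a unit vector `w` they come from
`‖w + τ g‖ ^ 2 = 1 + x ≤ exp x` with `x = 2 τ ⟪w, g⟫ + τ ^ 2 ‖g‖ ^ 2`. -/
lemma lintegral_enorm_residualStep_le (hp : 0 < p) (hb : p * τ ^ 2 ≤ 1 / 2)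
    (y : EuclideanSpace ℝ (Fin d)) :
    ∫⁻ M, ‖residualStep τ M y‖ₑ ^ p ∂gaussianMatrix d
      ≤ ENNReal.ofReal (Real.exp (p ^ 2 * τ ^ 2 + d * (p * τ ^ 2 / 2 + (p * τ ^ 2) ^ 2 / 2)))
        * ‖y‖ₑ ^ p := by
  rcases eq_or_ne y 0 with rfl | hy
  · simp [residualStep, hp]
  set w := ‖y‖⁻¹ • y with hw_def
  have hw : ‖w‖ = 1 := norm_smul_inv_norm hy
  simp_rw [enorm_residualStep _ hy, ENNReal.mul_rpow_of_nonneg _ _ hp.le]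
  rw [lintegral_const_mul' _ _ (by finiteness), mul_comm]
  gcongr
  rw [lintegral_comp_residualStep hw (f := fun z => ‖z‖ₑ ^ p) (by fun_prop)]
  calc _ ≤ ∫⁻ g, ENNReal.ofReal (Real.exp (inner ℝ ((p * τ) • w) g + (p * τ ^ 2 / 2) * ‖g‖ ^ 2))
        ∂stdGaussian (EuclideanSpace ℝ (Fin d)) := by
        refine lintegral_mono fun g => ?_
        rw [← ofReal_norm, ENNReal.ofReal_rpow_of_nonneg (norm_nonneg _) hp.le]
        apply ENNReal.ofReal_le_ofReal
        have h1 : ‖w + τ • g‖ ^ 2 = 1 + (2 * τ * inner ℝ w g + τ ^ 2 * ‖g‖ ^ 2) := by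
          rw [norm_add_sq_real, hw, inner_smul_right, norm_smul, mul_pow, Real.norm_eq_abs, sq_abs]
          ring
        have h2 : ‖w + τ • g‖ ^ p = (‖w + τ • g‖ ^ 2) ^ (p / 2) := by
          rw [← Real.rpow_natCast, ← Real.rpow_mul (norm_nonneg _)]
          congr 1; push_cast; ring
        rw [h2, inner_smul_left]
        calc _ ≤ (Real.exp (2 * τ * inner ℝ w g + τ ^ 2 * ‖g‖ ^ 2)) ^ (p / 2) := by
              apply Real.rpow_le_rpow (by positivity) _ (by positivity)
              rw [h1, add_comm]
              exact Real.add_one_le_exp _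
          _ = _ := by
              rw [← Real.exp_mul]
              congr 1
              simp
              ring
    _ ≤ _ := by
        refine (lintegral_exp_stdGaussian_le _ (by linarith)).trans (le_of_eq ?_)
        rw [norm_smul, hw, Fintype.card_fin]
        congr 2
        rw [Real.norm_eq_abs, mul_one, sq_abs]
        ring

/-- Truncated negative moments of one step. For a unit vector `w`, put `t = τ ⟪w, g⟫`: on `t ≥ -1/2` one
has `‖w + τ g‖ ≥ 1 + t ≥ exp (t - t ^ 2)`, and the complementary event contributes the last term. -/
lemma lintegral_min_enorm_inv_residualStep_le (hp : 0 < p) (hτ : 0 < τ) (hb : p * τ ^ 2 ≤ 1 / 4)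
    (c : ℝ≥0∞) (y : EuclideanSpace ℝ (Fin d)) :
    ∫⁻ M, min 1 (c * ‖residualStep τ M y‖ₑ⁻¹ ^ p) ∂gaussianMatrix d
      ≤ ENNReal.ofReal (Real.exp (p ^ 2 * τ ^ 2 + 2 * (p * τ ^ 2))) * (c * ‖y‖ₑ⁻¹ ^ p)
        + ENNReal.ofReal (Real.exp (-(1 / (8 * τ ^ 2)))) := by
  rcases eq_or_ne c 0 with rfl | hc
  · simp
  rcases eq_or_ne y 0 with rfl | hy
  · simp [hp, hc, ENNReal.mul_top, Real.exp_pos]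
  set w := ‖y‖⁻¹ • y with hw_def
  have hw : ‖w‖ = 1 := norm_smul_inv_norm hy
  have hyi : ∀ M : Fin d → Fin d → ℝ, c * ‖residualStep τ M y‖ₑ⁻¹ ^ p
      = (c * ‖y‖ₑ⁻¹ ^ p) * ‖residualStep τ M w‖ₑ⁻¹ ^ p := by
    intro M
    rw [enorm_residualStep _ hy, ENNReal.mul_inv (by simp [hy]) (by simp),
      ENNReal.mul_rpow_of_nonneg _ _ hp.le, mul_assoc]
  simp_rw [hyi]
  generalize c * ‖y‖ₑ⁻¹ ^ p = k
  rw [lintegral_comp_residualStep hw (f := fun z => min 1 (k * ‖z‖ₑ⁻¹ ^ p)) (by fun_prop)]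
  obtain ⟨F, hF⟩ : ∃ F : ℝ → ℝ≥0∞, F = fun x : ℝ =>
      k * ENNReal.ofReal (Real.exp (-(p * τ) * x + p * τ ^ 2 * x ^ 2))
      + ENNReal.ofReal (Real.exp (-(1 / (4 * τ ^ 2))))
        * ENNReal.ofReal (Real.exp (-(1 / (2 * τ)) * x + 0 * x ^ 2)) := ⟨_, rfl⟩
  have hFm : Measurable F := by rw [hF]; fun_prop
  have hpt : ∀ g : EuclideanSpace ℝ (Fin d), min 1 (k * ‖w + τ • g‖ₑ⁻¹ ^ p)
      ≤ F (inner ℝ w g) := by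
    intro g
    rw [hF]
    beta_reduce
    set x := inner ℝ w g with hx
    by_cases ht : -(1 / 2) ≤ τ * x
    · refine (min_le_right _ _).trans (le_trans ?_ le_self_add)
      gcongr
      have h1 : 1 + τ * x ≤ ‖w + τ • g‖ := by
        have := real_inner_le_norm w (w + τ • g)
        rw [inner_add_right, real_inner_self_eq_norm_sq, inner_smul_right, hw] at this
        linarith
      have h2 := (exp_sub_sq_le ht).trans h1
      calc _ ≤ (ENNReal.ofReal (Real.exp (τ * x - (τ * x) ^ 2)))⁻¹ ^ p := by
            gcongr
            rw [← ofReal_norm]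
            exact ENNReal.ofReal_le_ofReal h2
        _ = _ := by
            rw [← ENNReal.ofReal_inv_of_pos (Real.exp_pos _), ← Real.exp_neg,
              ENNReal.ofReal_rpow_of_pos (Real.exp_pos _), ← Real.exp_mul]
            congr 2; ring
    -- the second exponential is the Chernoff majorant of the indicator of `τ * x < -1 / 2`
    · refine (min_le_left _ _).trans (le_trans ?_ le_add_self)
      rw [← ENNReal.ofReal_mul (Real.exp_pos _).le, ← Real.exp_add, ← ENNReal.ofReal_one]
      apply ENNReal.ofReal_le_ofReal
      rw [Real.one_le_exp_iff]
      have : -(1 / (4 * τ ^ 2)) + (-(1 / (2 * τ)) * x + 0 * x ^ 2)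
          = (-(1 / 2) - τ * x) / (2 * τ ^ 2) := by
        field_simp; ring
      rw [this]
      push Not at ht
      exact div_nonneg (by linarith) (by positivity)
  refine (lintegral_mono hpt).trans ?_
  rw [← lintegral_map (μ := stdGaussian (EuclideanSpace ℝ (Fin d)))
    (g := fun g => inner ℝ w g) hFm (by fun_prop), map_inner_stdGaussian hw, hF,
    lintegral_add_left (by fun_prop), lintegral_const_mul _ (by fun_prop),
    lintegral_const_mul _ (by fun_prop)]
  refine add_le_add ?_ (le_of_eq ?_)
  · rw [mul_comm]
    gcongr
    refine (lintegral_exp_gaussianReal_le _ hb).trans ?_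
    apply ENNReal.ofReal_le_ofReal
    rw [Real.exp_le_exp]
    have : 0 ≤ p * τ ^ 2 := by positivity
    nlinarith
  · rw [lintegral_exp_gaussianReal _ (by norm_num), ← ENNReal.ofReal_mul (Real.exp_pos _).le]
    congr 1
    simp only [mul_zero, sub_zero, Real.sqrt_one, inv_one, one_mul]
    rw [← Real.exp_add]
    congr 1
    field_simp
    norm_num

end OneStep

/-! ### Nets of the unit sphere -/

/-- Volume comparison: the balls of radius `ε / 2` around the points of `s` are disjoint and contained
in the ball of radius `3 / 2`. -/
lemma card_le_of_separated_sphere {E : Type*} [NormedAddCommGroup E] [NormedSpace ℝ E]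
    [FiniteDimensional ℝ E] {ε : ℝ} (hε : 0 < ε) (hε1 : ε ≤ 1) (s : Finset E)
    (hs : ∀ x ∈ s, ‖x‖ = 1) (h : ∀ x ∈ s, ∀ y ∈ s, x ≠ y → ε ≤ ‖x - y‖) :
    (s.card : ℝ) ≤ (3 / ε) ^ Module.finrank ℝ E := by
  borelize E
  let μ : Measure E := Measure.addHaar
  have hdisj : Set.Pairwise (s : Set E)
      (Function.onFun Disjoint fun x => Metric.ball x (ε / 2)) := by
    intro x hx y hy hxy
    apply Metric.ball_disjoint_ball
    rw [dist_eq_norm]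
    linarith [h x hx y hy hxy]
  have hsub : (⋃ x ∈ s, Metric.ball x (ε / 2)) ⊆ Metric.ball (0 : E) (3 / 2) := by
    refine Set.iUnion₂_subset fun x hx => Metric.ball_subset_ball' ?_
    rw [dist_zero_right, hs x hx]
    linarith
  have h1 := measure_mono (μ := μ) hsub
  rw [measure_biUnion_finset hdisj fun _ _ => measurableSet_ball] at h1
  simp only [μ.addHaar_ball_of_pos _ (half_pos hε), Finset.sum_const, nsmul_eq_mul,
    μ.addHaar_ball_of_pos _ (by norm_num : (0 : ℝ) < 3 / 2), ← mul_assoc] at h1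
  have h2 := (ENNReal.mul_le_mul_iff_left (Metric.measure_ball_pos _ _ zero_lt_one).ne'
    measure_ball_lt_top.ne).1 h1
  have h3 := ENNReal.toReal_le_of_le_ofReal (by positivity) h2
  rw [ENNReal.toReal_mul, ENNReal.toReal_natCast, ENNReal.toReal_ofReal (by positivity),
    ← le_div_iff₀ (by positivity), ← div_pow] at h3
  have e : 3 / 2 / (ε / 2) = 3 / ε := by field_simp
  rwa [e] at h3

lemma exists_finset_sphere_net {E : Type*} [NormedAddCommGroup E] [NormedSpace ℝ E]
    [FiniteDimensional ℝ E] {ε : ℝ} (hε : 0 < ε) (hε1 : ε ≤ 1) :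
    ∃ s : Finset E, (∀ x ∈ s, ‖x‖ = 1) ∧ (∀ y : E, ‖y‖ = 1 → ∃ x ∈ s, ‖y - x‖ ≤ ε) ∧
      (s.card : ℝ) ≤ (3 / ε) ^ Module.finrank ℝ E := by
  classical
  let Sep : ℕ → Prop := fun n => ∃ s : Finset E, (∀ x ∈ s, ‖x‖ = 1) ∧
    (∀ x ∈ s, ∀ y ∈ s, x ≠ y → ε ≤ ‖x - y‖) ∧ s.card = n
  have hbound : ∀ n, Sep n → n ≤ ⌊(3 / ε) ^ Module.finrank ℝ E⌋₊ := by
    rintro n ⟨s, h1, h2, rfl⟩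
    exact Nat.le_floor (card_le_of_separated_sphere hε hε1 s h1 h2)
  have h0 : Sep 0 := ⟨∅, by simp, by simp, rfl⟩
  -- a separated set of maximal cardinality is a net
  obtain ⟨s, h1, h2, hcard⟩ := Nat.findGreatest_spec (Nat.zero_le _) h0
  refine ⟨s, h1, fun y hy => ?_, card_le_of_separated_sphere hε hε1 s h1 h2⟩
  by_contra! hfar
  have hys : y ∉ s := fun hmem => by
    have := hfar y hmem
    simp at this
    linarith
  have hSep : Sep (s.card + 1) := by
    refine ⟨insert y s, ?_, ?_, Finset.card_insert_of_notMem hys⟩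
    · intro x hx
      rcases Finset.mem_insert.1 hx with rfl | hx
      exacts [hy, h1 x hx]
    · intro x hx z hz hxz
      rcases Finset.mem_insert.1 hx with rfl | hx <;> rcases Finset.mem_insert.1 hz with rfl | hz
      · exact absurd rfl hxz
      · exact (hfar z hz).le
      · rw [norm_sub_rev]; exact (hfar x ‹_›).le
      · exact h2 x hx z hz hxz
  have := Nat.le_findGreatest (hbound _ hSep) hSep
  rw [← hcard] at this
  omega

/-! ### Operator norm and smallest singular value -/

section Matrices

variable {d : ℕ}

lemma norm_toEuclideanCLM_le (A : Matrix (Fin d) (Fin d) ℝ) (x : EuclideanSpace ℝ (Fin d)) :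
    ‖Matrix.toEuclideanCLM (n := Fin d) (𝕜 := ℝ) A x‖ ≤ opNorm A * ‖x‖ :=
  ContinuousLinearMap.le_opNorm _ _

lemma opNorm_nonneg (A : Matrix (Fin d) (Fin d) ℝ) : 0 ≤ opNorm A := norm_nonneg _

lemma opNorm_mul_le (A B : Matrix (Fin d) (Fin d) ℝ) : opNorm (A * B) ≤ opNorm A * opNorm B := by
  unfold opNorm
  rw [map_mul]
  exact norm_mul_le _ _

lemma opNorm_add_le (A B : Matrix (Fin d) (Fin d) ℝ) : opNorm (A + B) ≤ opNorm A + opNorm B := by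
  unfold opNorm
  rw [map_add]
  exact norm_add_le _ _

lemma opNorm_smul (c : ℝ) (A : Matrix (Fin d) (Fin d) ℝ) : opNorm (c • A) = |c| * opNorm A := by
  unfold opNorm
  rw [map_smul, norm_smul, Real.norm_eq_abs]

lemma opNorm_one_le : opNorm (1 : Matrix (Fin d) (Fin d) ℝ) ≤ 1 := by
  unfold opNorm
  rw [map_one]
  exact ContinuousLinearMap.norm_id_le

lemma opNorm_le_of_net {A : Matrix (Fin d) (Fin d) ℝ} {s : Finset (EuclideanSpace ℝ (Fin d))}
    {ε U : ℝ} (hε1 : ε ≤ 1 / 2) (hU : 0 ≤ U)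
    (hs : ∀ y : EuclideanSpace ℝ (Fin d), ‖y‖ = 1 → ∃ x ∈ s, ‖y - x‖ ≤ ε)
    (h : ∀ x ∈ s, ‖Matrix.toEuclideanCLM (n := Fin d) (𝕜 := ℝ) A x‖ ≤ U) : opNorm A ≤ 2 * U := by
  have key : opNorm A ≤ U + opNorm A * (1 / 2) := by
    refine ContinuousLinearMap.opNorm_le_of_unit_norm
      (add_nonneg hU (mul_nonneg (opNorm_nonneg A) (by norm_num))) fun y hy => ?_
    obtain ⟨x, hx, hxy⟩ := hs y hy
    have e : Matrix.toEuclideanCLM (n := Fin d) (𝕜 := ℝ) A y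
        = Matrix.toEuclideanCLM (n := Fin d) (𝕜 := ℝ) A x
          + Matrix.toEuclideanCLM (n := Fin d) (𝕜 := ℝ) A (y - x) := by
      rw [← map_add]; congr 1; abel
    rw [e]
    refine (norm_add_le _ _).trans (add_le_add (h x hx) ((norm_toEuclideanCLM_le _ _).trans ?_))
    exact mul_le_mul_of_nonneg_left (hxy.trans hε1) (opNorm_nonneg A)
  linarith

lemma le_norm_of_net {A : Matrix (Fin d) (Fin d) ℝ} {s : Finset (EuclideanSpace ℝ (Fin d))}
    {ε l : ℝ} (hA : opNorm A * ε ≤ l / 2)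
    (hs : ∀ y : EuclideanSpace ℝ (Fin d), ‖y‖ = 1 → ∃ x ∈ s, ‖y - x‖ ≤ ε)
    (h : ∀ x ∈ s, l ≤ ‖Matrix.toEuclideanCLM (n := Fin d) (𝕜 := ℝ) A x‖)
    (y : EuclideanSpace ℝ (Fin d)) :
    l / 2 * ‖y‖ ≤ ‖Matrix.toEuclideanCLM (n := Fin d) (𝕜 := ℝ) A y‖ := by
  rcases eq_or_ne y 0 with rfl | hy
  · simp
  have hw : ‖‖y‖⁻¹ • y‖ = 1 := norm_smul_inv_norm hy
  obtain ⟨x, hx, hxy⟩ := hs _ hw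
  have e : Matrix.toEuclideanCLM (n := Fin d) (𝕜 := ℝ) A x
      = Matrix.toEuclideanCLM (n := Fin d) (𝕜 := ℝ) A (‖y‖⁻¹ • y)
        - Matrix.toEuclideanCLM (n := Fin d) (𝕜 := ℝ) A (‖y‖⁻¹ • y - x) := by
    rw [← map_sub]; congr 1; abel
  have h1 := h x hx
  rw [e] at h1
  have h2 := norm_sub_le (Matrix.toEuclideanCLM (n := Fin d) (𝕜 := ℝ) A (‖y‖⁻¹ • y))
    (Matrix.toEuclideanCLM (n := Fin d) (𝕜 := ℝ) A (‖y‖⁻¹ • y - x))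
  have h3 := (norm_toEuclideanCLM_le A (‖y‖⁻¹ • y - x)).trans
    (mul_le_mul_of_nonneg_left hxy (opNorm_nonneg A))
  have h4 : ‖Matrix.toEuclideanCLM (n := Fin d) (𝕜 := ℝ) A (‖y‖⁻¹ • y)‖
      = ‖y‖⁻¹ * ‖Matrix.toEuclideanCLM (n := Fin d) (𝕜 := ℝ) A y‖ := by
    rw [map_smul, norm_smul, norm_inv, norm_norm]
  have hy0 : 0 < ‖y‖ := norm_pos_iff.2 hy
  rw [← le_div_iff₀ hy0, div_eq_inv_mul (‖_‖) ‖y‖, ← h4]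
  linarith

lemma le_sigmaMin (hd : 0 < d) {A : Matrix (Fin d) (Fin d) ℝ} {c : ℝ}
    (h : ∀ x, c * ‖x‖ ≤ ‖Matrix.toEuclideanCLM (n := Fin d) (𝕜 := ℝ) A x‖) : c ≤ sigmaMin A := by
  set T := Matrix.toEuclideanLin A with hT
  have hev := T.hasEigenvalue_adjoint_comp_self_sq_singularValues (n := d - 1) (by simp; omega)
  obtain ⟨v, hv, hv0⟩ := hev.exists_hasEigenvector
  rw [Module.End.mem_eigenspace_iff] at hv
  have h1 : ‖T v‖ ^ 2 = (T.singularValues (d - 1) * ‖v‖) ^ 2 := by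
    rw [← real_inner_self_eq_norm_sq, ← LinearMap.adjoint_inner_left, ← LinearMap.comp_apply, hv,
      inner_smul_left, real_inner_self_eq_norm_sq]
    simp [mul_pow]
  have hs := T.singularValues_nonneg (d - 1)
  have h2 : ‖T v‖ = T.singularValues (d - 1) * ‖v‖ :=
    (sq_eq_sq₀ (norm_nonneg _) (by positivity)).1 h1
  have h3 : c * ‖v‖ ≤ ‖T v‖ := h v
  rw [h2] at h3
  exact le_of_mul_le_mul_right h3 (norm_pos_iff.2 hv0)

/-! ### Partial products -/

variable {L n : ℕ}

lemma partialProduct_zero (W : Fin L → Matrix (Fin d) (Fin d) ℝ) : partialProduct W 0 = 1 := rfl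

lemma partialProduct_succ (W : Fin L → Matrix (Fin d) (Fin d) ℝ) (k : Fin L) :
    partialProduct W k.succ = W k * partialProduct W k.castSucc := by
  unfold partialProduct
  rw [Fin.induction_succ]

/-- Splitting off the first, that is the rightmost, factor. -/
lemma partialProduct_succ_eq_tail_mul (W : Fin (n + 1) → Matrix (Fin d) (Fin d) ℝ)
    (k : Fin (n + 1)) : partialProduct W k.succ = partialProduct (Fin.tail W) k * W 0 := by
  induction k using Fin.induction with
  | zero => rw [partialProduct_succ]; simp [partialProduct_zero]
  | succ j ih =>
    rw [partialProduct_succ, ← Fin.succ_castSucc, ih, partialProduct_succ, mul_assoc]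
    rfl

lemma hitsWithin_of_partialProduct {τ : ℝ} {B : Set (EuclideanSpace ℝ (Fin d))}
    (x : Fin n → Fin d → Fin d → ℝ) (k : Fin (n + 1)) (y : EuclideanSpace ℝ (Fin d))
    (h : Matrix.toEuclideanCLM (n := Fin d) (𝕜 := ℝ)
      (partialProduct (fun j => 1 + τ • Matrix.of (x j)) k) y ∈ B) :
    HitsWithin (residualStep τ) B n x y := by
  induction n generalizing y with
  | zero =>
    rw [Fin.eq_zero k, partialProduct_zero, map_one] at h
    exact h
  | succ n ih =>
    cases k using Fin.cases with
    | zero =>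
      rw [partialProduct_zero, map_one] at h
      exact Or.inl h
    | succ k =>
      refine Or.inr (ih (Fin.tail x) k _ ?_)
      rw [partialProduct_succ_eq_tail_mul, map_mul] at h
      have e : residualStep τ (x 0) y
          = Matrix.toEuclideanCLM (n := Fin d) (𝕜 := ℝ) (1 + τ • Matrix.of (x 0)) y := by
        rw [map_add, map_one, map_smul]; rfl
      rw [e]
      exact h

/-! ### Stability under perturbation of the factors -/

lemma exists_inv_opNorm_le {A : Matrix (Fin d) (Fin d) ℝ} {b : ℝ} (hb : 0 < b)
    (h : ∀ x, b * ‖x‖ ≤ ‖Matrix.toEuclideanCLM (n := Fin d) (𝕜 := ℝ) A x‖) :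
    ∃ G, A * G = 1 ∧ opNorm G ≤ b⁻¹ := by
  have hinj : Function.Injective A.mulVec := by
    intro x y hxy
    have h1 := h (WithLp.toLp 2 (x - y))
    rw [Matrix.toEuclideanCLM_toLp, Matrix.mulVec_sub, hxy, sub_self] at h1
    simp only [WithLp.toLp_zero, norm_zero] at h1
    have h2 : ‖(WithLp.toLp 2 (x - y) : EuclideanSpace ℝ (Fin d))‖ ≤ 0 := by
      by_contra! hlt
      linarith [mul_pos hb hlt]
    simpa [sub_eq_zero] using h2
  have hu := Matrix.mulVec_injective_iff_isUnit.1 hinj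
  refine ⟨A⁻¹, Matrix.mul_nonsing_inv _ ((Matrix.isUnit_iff_isUnit_det _).1 hu), ?_⟩
  refine ContinuousLinearMap.opNorm_le_bound _ (by positivity) fun x => ?_
  have h1 := h (Matrix.toEuclideanCLM (n := Fin d) (𝕜 := ℝ) A⁻¹ x)
  rw [← mul_apply_eq_comp, ← map_mul,
    Matrix.mul_nonsing_inv _ ((Matrix.isUnit_iff_isUnit_det _).1 hu), map_one] at h1
  rw [← div_eq_inv_mul, le_div_iff₀ hb, mul_comm]
  exact h1

/-- Variation of constants: the perturbed product is the unperturbed one times a matrix `Q` close to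
the identity, provided that the unperturbed products are bounded above and below. -/
lemma exists_partialProduct_add_eq_mul {A R : Fin L → Matrix (Fin d) (Fin d) ℝ} {a b r : ℝ}
    (hb : 0 < b) (ha : ∀ k, opNorm (partialProduct A k) ≤ a)
    (hA : ∀ k x, b * ‖x‖ ≤ ‖Matrix.toEuclideanCLM (n := Fin d) (𝕜 := ℝ) (partialProduct A k) x‖)
    (hR : ∀ k, opNorm (R k) ≤ r) (k : Fin (L + 1)) :
    ∃ Q, partialProduct (fun j => A j + R j) k = partialProduct A k * Q ∧
      opNorm (Q - 1) ≤ (1 + b⁻¹ * r * a) ^ (k : ℕ) - 1 := by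
  induction k using Fin.induction with
  | zero => exact ⟨1, by simp [partialProduct_zero], by simp [opNorm]⟩
  | succ k ih =>
    obtain ⟨Q, hQ, hQn⟩ := ih
    obtain ⟨G, hG, hGn⟩ := exists_inv_opNorm_le hb (hA k.succ)
    refine ⟨Q + G * R k * partialProduct A k.castSucc * Q, ?_, ?_⟩
    · rw [partialProduct_succ, hQ, mul_add, mul_assoc G, mul_assoc G, ← mul_assoc _ G, hG,
        partialProduct_succ A]
      noncomm_ring
    · have hr : 0 ≤ r := (opNorm_nonneg _).trans (hR k)
      have ha0 : 0 ≤ a := (opNorm_nonneg _).trans (ha 0)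
      have hQ1 : opNorm Q ≤ (1 + b⁻¹ * r * a) ^ (k : ℕ) := by
        calc opNorm Q = opNorm ((Q - 1) + 1) := by rw [sub_add_cancel]
          _ ≤ _ := (opNorm_add_le _ _).trans (by
              have := opNorm_one_le (d := d)
              rw [Fin.val_castSucc] at hQn
              linarith)
      have hterm : opNorm (G * R k * partialProduct A k.castSucc * Q)
          ≤ b⁻¹ * r * a * (1 + b⁻¹ * r * a) ^ (k : ℕ) := by
        refine (opNorm_mul_le _ _).trans (mul_le_mul ((opNorm_mul_le _ _).trans (mul_le_mul
          ((opNorm_mul_le _ _).trans (mul_le_mul hGn (hR k) (opNorm_nonneg _) (by positivity)))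
          (ha _) (opNorm_nonneg _) (by positivity))) hQ1 (opNorm_nonneg _) (by positivity))
      have : Q + G * R k * partialProduct A k.castSucc * Q - 1
          = (Q - 1) + G * R k * partialProduct A k.castSucc * Q := by abel
      rw [this]
      refine (opNorm_add_le _ _).trans ?_
      rw [Fin.val_succ, pow_succ]
      rw [Fin.val_castSucc] at hQn
      linarith

lemma partialProduct_add_bounds {A R : Fin L → Matrix (Fin d) (Fin d) ℝ} {a b r : ℝ}
    (hb : 0 < b) (ha : ∀ k, opNorm (partialProduct A k) ≤ a)
    (hA : ∀ k x, b * ‖x‖ ≤ ‖Matrix.toEuclideanCLM (n := Fin d) (𝕜 := ℝ) (partialProduct A k) x‖)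
    (hR : ∀ k, opNorm (R k) ≤ r) (hr : L * (b⁻¹ * r * a) ≤ 1 / 16) (hd : 0 < d)
    (k : Fin (L + 1)) :
    opNorm (partialProduct (fun j => A j + R j) k) ≤ 2 * a ∧
      b / 2 ≤ sigmaMin (partialProduct (fun j => A j + R j) k) := by
  obtain ⟨Q, hQ, hQn⟩ := exists_partialProduct_add_eq_mul hb ha hA hR k
  have ha0 : 0 ≤ a := (opNorm_nonneg _).trans (ha 0)
  have hη : opNorm (Q - 1) ≤ 1 / 2 := by
    rcases Nat.eq_zero_or_pos L with hL | hL
    · subst hL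
      have : (k : ℕ) = 0 := by omega
      rw [this] at hQn
      norm_num at hQn
      linarith
    have hr0 : 0 ≤ r := (opNorm_nonneg _).trans (hR ⟨0, hL⟩)
    have h0 : 0 ≤ b⁻¹ * r * a := by positivity
    have h1 : (1 + b⁻¹ * r * a) ^ (k : ℕ) ≤ Real.exp (1 / 16) := by
      calc _ ≤ (1 + b⁻¹ * r * a) ^ L := by
            apply pow_le_pow_right₀ (by linarith)
            omega
        _ ≤ (Real.exp (b⁻¹ * r * a)) ^ L := by
            gcongr
            rw [add_comm]; exact Real.add_one_le_exp _
        _ = Real.exp (L * (b⁻¹ * r * a)) := (Real.exp_nat_mul _ _).symm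
        _ ≤ _ := Real.exp_le_exp.2 hr
    have h2 : Real.exp (1 / 16) ≤ 3 / 2 := by
      have := Real.exp_bound_div_one_sub_of_interval (x := 1 / 16) (by norm_num) (by norm_num)
      refine this.trans (by norm_num)
    linarith
  constructor
  · rw [hQ]
    have hQ2 : opNorm Q ≤ 2 := by
      calc opNorm Q = opNorm ((Q - 1) + 1) := by rw [sub_add_cancel]
        _ ≤ _ := (opNorm_add_le _ _).trans (by linarith [opNorm_one_le (d := d)])
    calc _ ≤ opNorm (partialProduct A k) * opNorm Q := opNorm_mul_le _ _
      _ ≤ a * 2 := mul_le_mul (ha k) hQ2 (opNorm_nonneg _) ha0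
      _ = _ := mul_comm _ _
  · refine le_sigmaMin hd fun x => ?_
    rw [hQ, map_mul, mul_apply_eq_comp]
    refine le_trans ?_ (hA k _)
    have e : Matrix.toEuclideanCLM (n := Fin d) (𝕜 := ℝ) Q x
        = x + Matrix.toEuclideanCLM (n := Fin d) (𝕜 := ℝ) (Q - 1) x := by
      rw [map_sub, map_one]; simp
    have h1 := norm_sub_le (x + Matrix.toEuclideanCLM (n := Fin d) (𝕜 := ℝ) (Q - 1) x)
      (Matrix.toEuclideanCLM (n := Fin d) (𝕜 := ℝ) (Q - 1) x)
    rw [add_sub_cancel_right, ← e] at h1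
    have h2 := (norm_toEuclideanCLM_le (Q - 1) x).trans
      (mul_le_mul_of_nonneg_right hη (norm_nonneg _))
    have h3 : ‖x‖ / 2 ≤ ‖Matrix.toEuclideanCLM (n := Fin d) (𝕜 := ℝ) Q x‖ := by linarith
    nlinarith

end Matrices

/-! ### The law of the family of matrices -/

lemma IsIIDStdGaussian.aemeasurable {Ω : Type*} [MeasurableSpace Ω] {P : Measure Ω} {L d : ℕ}
    {N : Fin L → Ω → Matrix (Fin d) (Fin d) ℝ} (h : IsIIDStdGaussian P N) :
    AEMeasurable (fun ω k i j => N k ω i j) P :=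
  aemeasurable_pi_iff.2 fun k => aemeasurable_pi_iff.2 fun i => aemeasurable_pi_iff.2 fun j =>
    (h.hasLaw k i j).aemeasurable

lemma IsIIDStdGaussian.map_eq {Ω : Type*} [MeasurableSpace Ω] {P : Measure Ω}
    [IsProbabilityMeasure P] {L d : ℕ}
    {N : Fin L → Ω → Matrix (Fin d) (Fin d) ℝ} (h : IsIIDStdGaussian P N) :
    P.map (fun ω k i j => N k ω i j) = Measure.pi fun _ : Fin L => gaussianMatrix d := by
  have hm : ∀ p : Fin L × Fin d × Fin d, AEMeasurable (fun ω => N p.1 ω p.2.1 p.2.2) P :=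
    fun p => (h.hasLaw p.1 p.2.1 p.2.2).aemeasurable
  have h1 := (iIndepFun_iff_map_fun_eq_pi_map hm).1 h.indep
  simp_rw [fun p : Fin L × Fin d × Fin d => (h.hasLaw p.1 p.2.1 p.2.2).map_eq] at h1
  -- the `L d ^ 2`-fold product measure is the iterated product measure, by comparison on boxes
  have hunc : (Measure.pi fun _ : Fin L => gaussianMatrix d).map
      (fun x (p : Fin L × Fin d × Fin d) => x p.1 p.2.1 p.2.2)
      = Measure.pi fun _ => gaussianReal 0 1 := by
    refine (Measure.pi_eq fun s hs => ?_).symm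
    rw [Measure.map_apply (by fun_prop) (MeasurableSet.univ_pi hs)]
    have hpre : (fun (x : Fin L → Fin d → Fin d → ℝ) (p : Fin L × Fin d × Fin d) =>
        x p.1 p.2.1 p.2.2) ⁻¹' Set.univ.pi s
        = Set.univ.pi fun k => Set.univ.pi fun i => Set.univ.pi fun j => s (k, i, j) := by
      ext x
      simp [Set.mem_pi]
    rw [hpre, Measure.pi_pi]
    simp_rw [gaussianMatrix, Measure.pi_pi, Fintype.prod_prod_type]
  rw [← hunc] at h1
  have h2 := congrArg (Measure.map fun (f : Fin L × Fin d × Fin d → ℝ) k i j => f (k, i, j)) h1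
  rw [AEMeasurable.map_map_of_aemeasurable (Measurable.aemeasurable (by fun_prop))
    (aemeasurable_pi_iff.2 hm), Measure.map_map (by fun_prop) (by fun_prop)] at h2
  exact h2.trans Measure.map_id

/-! ### Tail bounds for a fixed vector -/

lemma one_le_rpow_iff {a p : ℝ} (ha : 0 ≤ a) (hp : 0 < p) : 1 ≤ a ^ p ↔ 1 ≤ a := by
  conv_lhs => rw [← Real.one_rpow p]
  exact Real.rpow_le_rpow_iff zero_le_one ha hp

section Tail

variable {L d : ℕ} {τ p : ℝ}

lemma measure_exists_norm_ge_le (hp : 0 < p) (hb : p * τ ^ 2 ≤ 1 / 2) {U : ℝ} (hU : 0 < U)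
    {w : EuclideanSpace ℝ (Fin d)} (hw : ‖w‖ = 1) :
    Measure.pi (fun _ : Fin L => gaussianMatrix d)
        {x | HitsWithin (residualStep τ) {z | U ≤ ‖z‖} L x w}
      ≤ ENNReal.ofReal (Real.exp
          (L * (p ^ 2 * τ ^ 2 + d * (p * τ ^ 2 / 2 + (p * τ ^ 2) ^ 2 / 2))) * U⁻¹ ^ p) := by
  have hβ : 0 ≤ p * τ ^ 2 := by positivity
  have hUp : 0 < U⁻¹ ^ p := Real.rpow_pos_of_pos (inv_pos.2 hU) p
  have h := measure_hitsWithin_le (gaussianMatrix d) measurable_residualStep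
    (Φ := fun z => ENNReal.ofReal (U⁻¹ ^ p) * ‖z‖ₑ ^ p) (q := 0)
    (m := ENNReal.ofReal (Real.exp (p ^ 2 * τ ^ 2 + d * (p * τ ^ 2 / 2 + (p * τ ^ 2) ^ 2 / 2))))
    (by fun_prop)
    (by rw [← ENNReal.ofReal_one]
        exact ENNReal.ofReal_le_ofReal (Real.one_le_exp (by positivity)))
    (fun c y => by
      refine (lintegral_mono fun M => min_le_right _ _).trans ?_
      simp_rw [← mul_assoc]
      rw [lintegral_const_mul'' _ (by
        have := measurable_residualStep (d := d) (τ := τ)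
        have h2 : Measurable fun M => residualStep τ M y :=
          this.comp (measurable_id.prodMk measurable_const)
        fun_prop), add_zero]
      refine (mul_le_mul_right (lintegral_enorm_residualStep_le hp hb y) _).trans (le_of_eq ?_)
      ring) L w
  have hset : {z : EuclideanSpace ℝ (Fin d) | 1 ≤ ENNReal.ofReal (U⁻¹ ^ p) * ‖z‖ₑ ^ p}
      = {z | U ≤ ‖z‖} := by
    ext z
    simp only [Set.mem_ofPred_eq]
    rw [← ofReal_norm, ENNReal.ofReal_rpow_of_nonneg (norm_nonneg _) hp.le,
      ← ENNReal.ofReal_mul hUp.le, ENNReal.one_le_ofReal,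
      ← Real.mul_rpow (by positivity) (norm_nonneg _), ← div_eq_inv_mul,
      one_le_rpow_iff (by positivity) hp, one_le_div hU]
  rw [hset] at h
  refine h.trans (le_of_eq ?_)
  rw [← ofReal_norm, hw, ENNReal.ofReal_one, ENNReal.one_rpow, mul_one, mul_zero, add_zero,
    ← ENNReal.ofReal_pow (Real.exp_pos _).le, ← Real.exp_nat_mul,
    ← ENNReal.ofReal_mul (Real.exp_pos _).le]

lemma measure_exists_norm_le_le (hp : 0 < p) (hτ : 0 < τ) (hb : p * τ ^ 2 ≤ 1 / 4) {l : ℝ}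
    (hl : 0 < l) {w : EuclideanSpace ℝ (Fin d)} (hw : ‖w‖ = 1) :
    Measure.pi (fun _ : Fin L => gaussianMatrix d)
        {x | HitsWithin (residualStep τ) {z | ‖z‖ ≤ l} L x w}
      ≤ ENNReal.ofReal (Real.exp (L * (p ^ 2 * τ ^ 2 + 2 * (p * τ ^ 2))) * l ^ p
          + L * Real.exp (-(1 / (8 * τ ^ 2)))) := by
  have hlp : 0 < l ^ p := Real.rpow_pos_of_pos hl p
  have h := measure_hitsWithin_le (gaussianMatrix d) measurable_residualStep
    (Φ := fun z => ENNReal.ofReal (l ^ p) * ‖z‖ₑ⁻¹ ^ p)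
    (q := ENNReal.ofReal (Real.exp (-(1 / (8 * τ ^ 2)))))
    (m := ENNReal.ofReal (Real.exp (p ^ 2 * τ ^ 2 + 2 * (p * τ ^ 2))))
    (by fun_prop)
    (by rw [← ENNReal.ofReal_one]
        exact ENNReal.ofReal_le_ofReal (Real.one_le_exp (by positivity)))
    (fun c y => by
      simp_rw [← mul_assoc c]
      exact lintegral_min_enorm_inv_residualStep_le hp hτ hb _ y) L w
  have hset : {z : EuclideanSpace ℝ (Fin d) | 1 ≤ ENNReal.ofReal (l ^ p) * ‖z‖ₑ⁻¹ ^ p}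
      = {z | ‖z‖ ≤ l} := by
    ext z
    simp only [Set.mem_ofPred_eq]
    rcases eq_or_ne z 0 with rfl | hz
    · simp [hp, hlp, hl.le, ENNReal.mul_top]
    have hz0 : 0 < ‖z‖ := norm_pos_iff.2 hz
    rw [← ofReal_norm, ← ENNReal.ofReal_inv_of_pos hz0,
      ENNReal.ofReal_rpow_of_pos (inv_pos.2 hz0), ← ENNReal.ofReal_mul hlp.le,
      ENNReal.one_le_ofReal, ← Real.mul_rpow hl.le (by positivity), ← div_eq_mul_inv,
      one_le_rpow_iff (by positivity) hp, one_le_div hz0]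
  rw [hset] at h
  refine h.trans (le_of_eq ?_)
  rw [← ofReal_norm, hw, ENNReal.ofReal_one, inv_one, ENNReal.one_rpow, mul_one,
    ← ENNReal.ofReal_pow (Real.exp_pos _).le, ← Real.exp_nat_mul,
    ← ENNReal.ofReal_mul (Real.exp_pos _).le, ← ENNReal.ofReal_natCast (n := L),
    ← ENNReal.ofReal_mul (Nat.cast_nonneg _), ← ENNReal.ofReal_add (by positivity) (by positivity)]

end Tail

/-! ### Choice of constants -/

/-- The constraints on `(s, L, d, u)` under which the bounds are proved. -/
structure Admissible (s : ℝ) (L d : ℕ) (u : ℝ) : Prop where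
  s_pos : 0 < s
  two_le_d : 2 ≤ (d : ℝ)
  le_u : 1 + 64 * s ^ 2 ≤ u
  sq_le : u ^ 2 ≤ √L
  le_sqrt : 16 * s ^ 2 + 2 ≤ √L

namespace Admissible

variable {s u : ℝ} {L d : ℕ}

lemma d_pos (h : Admissible s L d u) : 0 < (d : ℝ) := by linarith [h.two_le_d]

lemma u_pos (h : Admissible s L d u) : 0 < u := by nlinarith [h.le_u, sq_nonneg s]

lemma L_pos (h : Admissible s L d u) : 0 < (L : ℝ) :=
  Real.sqrt_pos.1 (by nlinarith [h.le_sqrt, sq_nonneg s])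

lemma two_mul_sqrt_le (h : Admissible s L d u) : 2 * √(L : ℝ) ≤ L := by
  nlinarith [Real.sq_sqrt h.L_pos.le, h.le_sqrt, sq_nonneg s, Real.sqrt_nonneg (L : ℝ)]

lemma two_mul_u_le (h : Admissible s L d u) : 2 * u ≤ L := by
  nlinarith [h.two_mul_sqrt_le, h.sq_le, h.le_u, sq_nonneg s]

lemma sq_s_le (h : Admissible s L d u) : s ^ 2 ≤ L := by
  nlinarith [h.two_mul_sqrt_le, h.le_sqrt, sq_nonneg s]

lemma sq_div_sqrt (h : Admissible s L d u) : (s / √((L : ℝ) * d)) ^ 2 = s ^ 2 / (L * d) := by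
  rw [div_pow, Real.sq_sqrt (mul_pos h.L_pos h.d_pos).le]

lemma mul_sq_div_sqrt (h : Admissible s L d u) :
    d * u / (2 * s ^ 2) * (s / √((L : ℝ) * d)) ^ 2 = u / (2 * L) := by
  have := h.s_pos
  have := h.L_pos
  have := h.d_pos
  rw [h.sq_div_sqrt]
  field_simp

lemma mul_sq_div_sqrt_le (h : Admissible s L d u) :
    d * u / (2 * s ^ 2) * (s / √((L : ℝ) * d)) ^ 2 ≤ 1 / 4 := by
  rw [h.mul_sq_div_sqrt, div_le_iff₀ (by linarith [h.L_pos])]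
  linarith [h.two_mul_u_le]

/-- The moment exponent is `p = d u / (2 s ^ 2)`; it turns `p τ ^ 2` into `u / (2 L)`. -/
lemma exponent_pos (h : Admissible s L d u) : 0 < d * u / (2 * s ^ 2) :=
  div_pos (mul_pos h.d_pos h.u_pos) (by have := h.s_pos; positivity)

/-- The truncated events of all `L` steps together are negligible; the main use of `u ^ 2 ≤ √L`. -/
lemma bad_step_bound (h : Admissible s L d u) :
    L * Real.exp (-(1 / (8 * (s / √((L : ℝ) * d)) ^ 2)))
      ≤ Real.exp (-(d * u ^ 2 / (8 * s ^ 2))) := by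
  have hs := h.s_pos
  have hL := h.L_pos
  have hd := h.d_pos
  set r := √(L : ℝ) with hr
  have hr2 : r ^ 2 = L := Real.sq_sqrt hL.le
  have hr0 : 0 ≤ r := Real.sqrt_nonneg _
  have h1 : (L : ℝ) ≤ Real.exp (2 * r) := by
    rw [← hr2, two_mul, Real.exp_add, ← pow_two]
    gcongr
    linarith [Real.add_one_le_exp r]
  have e : 1 / (8 * (s / √((L : ℝ) * d)) ^ 2) = L * d / (8 * s ^ 2) := by
    rw [h.sq_div_sqrt]
    field_simp
  rw [e]
  calc _ ≤ Real.exp (2 * r) * Real.exp (-(L * d / (8 * s ^ 2))) := by gcongr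
    _ = Real.exp (2 * r - L * d / (8 * s ^ 2)) := by rw [← Real.exp_add]; congr 1
    _ ≤ _ := by
      rw [Real.exp_le_exp]
      have h2 : d * u ^ 2 / (8 * s ^ 2) ≤ d * r / (8 * s ^ 2) := by
        gcongr
        exact h.sq_le
      have h3 : 2 * r ≤ L * d / (8 * s ^ 2) - d * r / (8 * s ^ 2) := by
        rw [← sub_div, le_div_iff₀ (by positivity), ← hr2]
        have h4 : 16 * s ^ 2 ≤ d * (r - 1) := by
          nlinarith [h.le_sqrt, h.two_le_d]
        nlinarith [mul_le_mul_of_nonneg_left h4 hr0]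
      linarith

lemma measure_exists_norm_ge (h : Admissible s L d u) {w : EuclideanSpace ℝ (Fin d)}
    (hw : ‖w‖ = 1) :
    Measure.pi (fun _ : Fin L => gaussianMatrix d)
        {x | HitsWithin (residualStep (s / √((L : ℝ) * d)))
          {z | Real.exp (s ^ 2 / 2 + u) ≤ ‖z‖} L x w}
      ≤ ENNReal.ofReal (Real.exp (-(d * u ^ 2 / (8 * s ^ 2)))) := by
  have hs := h.s_pos
  have hL := h.L_pos
  have hd := h.d_pos
  refine (measure_exists_norm_ge_le h.exponent_pos (by linarith [h.mul_sq_div_sqrt_le])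
    (Real.exp_pos _) hw).trans (ENNReal.ofReal_le_ofReal ?_)
  rw [← Real.exp_neg, ← Real.exp_mul, ← Real.exp_add, Real.exp_le_exp, h.mul_sq_div_sqrt,
    h.sq_div_sqrt]
  have h1 : d * u ^ 2 / (8 * L) ≤ d * u ^ 2 / (8 * s ^ 2) := by
    gcongr
    exact h.sq_s_le
  have e : L * ((d * u / (2 * s ^ 2)) ^ 2 * (s ^ 2 / (L * d))
      + d * (u / (2 * L) / 2 + (u / (2 * L)) ^ 2 / 2))
      + -(s ^ 2 / 2 + u) * (d * u / (2 * s ^ 2))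
      = d * u ^ 2 / (8 * L) - 2 * (d * u ^ 2 / (8 * s ^ 2)) := by
    field_simp
    ring
  rw [e]
  linarith

lemma measure_exists_norm_le (h : Admissible s L d u) {w : EuclideanSpace ℝ (Fin d)}
    (hw : ‖w‖ = 1) :
    Measure.pi (fun _ : Fin L => gaussianMatrix d)
        {x | HitsWithin (residualStep (s / √((L : ℝ) * d)))
          {z | ‖z‖ ≤ Real.exp (-(2 * s ^ 2 / d) - u)} L x w}
      ≤ ENNReal.ofReal (2 * Real.exp (-(d * u ^ 2 / (8 * s ^ 2)))) := by
  have hs := h.s_pos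
  have hL := h.L_pos
  have hd := h.d_pos
  refine (measure_exists_norm_le_le h.exponent_pos (by positivity) h.mul_sq_div_sqrt_le
    (Real.exp_pos _) hw).trans (ENNReal.ofReal_le_ofReal ?_)
  rw [two_mul (Real.exp _)]
  refine add_le_add ?_ h.bad_step_bound
  rw [← Real.exp_mul, ← Real.exp_add, Real.exp_le_exp, h.mul_sq_div_sqrt, h.sq_div_sqrt]
  have h1 : 0 ≤ d * u ^ 2 / (8 * s ^ 2) := by positivity
  have e : L * ((d * u / (2 * s ^ 2)) ^ 2 * (s ^ 2 / (L * d)) + 2 * (u / (2 * L)))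
      + (-(2 * s ^ 2 / d) - u) * (d * u / (2 * s ^ 2))
      = - 2 * (d * u ^ 2 / (8 * s ^ 2)) := by
    field_simp
    ring
  rw [e]
  linarith

/-! ### The union bound over the net -/

/-- The mesh of the net of the unit sphere: a quarter of the ratio of the two norm bounds. -/
def mesh (s : ℝ) (d : ℕ) (u : ℝ) : ℝ :=
  1 / 4 * Real.exp (-(2 * s ^ 2 / d + s ^ 2 / 2 + 2 * u))

lemma mesh_le (h : Admissible s L d u) : mesh s d u ≤ 1 / 4 := by
  have := h.u_pos
  have : Real.exp (-(2 * s ^ 2 / d + s ^ 2 / 2 + 2 * u)) ≤ 1 :=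
    Real.exp_le_one_iff.2 (neg_nonpos.2 (by positivity))
  unfold mesh
  linarith

lemma two_mul_sq_div_le (h : Admissible s L d u) : 2 * s ^ 2 / d ≤ s ^ 2 := by
  rw [div_le_iff₀ h.d_pos]
  nlinarith [h.two_le_d, sq_nonneg s]

/-- The cardinality of the net is absorbed by the gain in the exponent. -/
lemma net_card_mul_le (h : Admissible s L d u) :
    (3 / mesh s d u) ^ d * (3 * Real.exp (-(d * u ^ 2 / (8 * s ^ 2))))
      ≤ 8 * Real.exp (-(d * u ^ 2 / (32 * s ^ 2))) := by
  have hs := h.s_pos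
  have hd := h.d_pos
  have hu := h.le_u
  have h1 : 3 / mesh s d u ≤ Real.exp (6 * u) := by
    have e : 3 / mesh s d u = 12 * Real.exp (2 * s ^ 2 / d + s ^ 2 / 2 + 2 * u) := by
      rw [mesh, Real.exp_neg]
      field_simp
      norm_num
    have h12 : (12 : ℝ) ≤ Real.exp 3 := by
      have h2 := Real.exp_one_gt_d9
      have : Real.exp 3 = Real.exp 1 ^ 3 := by rw [← Real.exp_nat_mul]; norm_num
      rw [this]
      calc (12 : ℝ) ≤ 2.7 ^ 3 := by norm_num
        _ ≤ _ := by gcongr; linarith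
    rw [e]
    calc _ ≤ Real.exp 3 * Real.exp (2 * s ^ 2 / d + s ^ 2 / 2 + 2 * u) := by gcongr
      _ = Real.exp (3 + (2 * s ^ 2 / d + s ^ 2 / 2 + 2 * u)) := (Real.exp_add _ _).symm
      _ ≤ _ := by
        rw [Real.exp_le_exp]
        nlinarith [h.two_mul_sq_div_le, sq_nonneg s]
  have hm : 0 < mesh s d u := by unfold mesh; positivity
  have h2 : 6 * u ≤ 3 * u ^ 2 / (32 * s ^ 2) := by
    rw [le_div_iff₀ (by positivity)]
    nlinarith [h.u_pos]
  calc _ ≤ Real.exp (6 * u) ^ d * (3 * Real.exp (-(d * u ^ 2 / (8 * s ^ 2)))) := by gcongr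
    _ = 3 * Real.exp (d * (6 * u) - d * u ^ 2 / (8 * s ^ 2)) := by
      rw [← Real.exp_nat_mul, mul_left_comm, ← Real.exp_add]
      congr 2
    _ ≤ 8 * Real.exp (-(d * u ^ 2 / (32 * s ^ 2))) := by
      gcongr
      · norm_num
      · have e : d * u ^ 2 / (8 * s ^ 2) - d * u ^ 2 / (32 * s ^ 2)
            = d * (3 * u ^ 2 / (32 * s ^ 2)) := by
          field_simp
          ring
        nlinarith [mul_le_mul_of_nonneg_left h2 hd.le]

/-- The deterministic part: bounds along the orbits of a net imply the bounds for all perturbations. -/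
lemma bounds_of_net (h : Admissible s L d u) {S : Finset (EuclideanSpace ℝ (Fin d))}
    (hS : ∀ y : EuclideanSpace ℝ (Fin d), ‖y‖ = 1 → ∃ x ∈ S, ‖y - x‖ ≤ mesh s d u)
    {x : Fin L → Fin d → Fin d → ℝ}
    (hup : ∀ w ∈ S, ¬ HitsWithin (residualStep (s / √((L : ℝ) * d)))
      {z | Real.exp (s ^ 2 / 2 + u) ≤ ‖z‖} L x w)
    (hlo : ∀ w ∈ S, ¬ HitsWithin (residualStep (s / √((L : ℝ) * d)))
      {z | ‖z‖ ≤ Real.exp (-(2 * s ^ 2 / d) - u)} L x w)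
    (θ : Fin L → Matrix (Fin d) (Fin d) ℝ)
    (hθ : ∀ k, opNorm (θ k) ≤ 1 / 64 * Real.exp (-2 * s ^ 2 - 4 * u)) (k : Fin L) :
    opNorm (partialProduct (residualWeight s (fun j => Matrix.of (x j)) θ) k.succ)
        ≤ 4 * Real.exp (s ^ 2 / 2 + u) ∧
      1 / 4 * Real.exp (-(2 * s ^ 2 / (d : ℝ)) - u)
        ≤ sigmaMin (partialProduct (residualWeight s (fun j => Matrix.of (x j)) θ) k.succ) := by
  have hL := h.L_pos
  set τ := s / √((L : ℝ) * d) with hτ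
  set A : Fin L → Matrix (Fin d) (Fin d) ℝ := fun j => 1 + τ • Matrix.of (x j) with hA
  set U := Real.exp (s ^ 2 / 2 + u) with hU
  set l := Real.exp (-(2 * s ^ 2 / (d : ℝ)) - u) with hl
  have hU0 : 0 < U := Real.exp_pos _
  have hl0 : 0 < l := Real.exp_pos _
  have ha : ∀ k, opNorm (partialProduct A k) ≤ 2 * U := fun k =>
    opNorm_le_of_net (by linarith [h.mesh_le]) hU0.le hS fun w hw =>
      le_of_not_ge fun hge => hup w hw (hitsWithin_of_partialProduct x k w hge)
  have hUl : U * mesh s d u = l / 4 := by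
    rw [hU, hl, mesh, mul_left_comm, ← Real.exp_add, one_div, div_eq_inv_mul _ (4 : ℝ)]
    congr 2
    ring
  have hb : ∀ k y, l / 2 * ‖y‖
      ≤ ‖Matrix.toEuclideanCLM (n := Fin d) (𝕜 := ℝ) (partialProduct A k) y‖ := fun k =>
    le_norm_of_net (by
      have hm : 0 ≤ mesh s d u := by unfold mesh; positivity
      nlinarith [mul_le_mul_of_nonneg_right (ha k) hm]) hS fun w hw =>
      le_of_not_ge fun hge => hlo w hw (hitsWithin_of_partialProduct x k w hge)
  have hR : ∀ k, opNorm ((1 / (L : ℝ)) • θ k)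
      ≤ 1 / L * (1 / 64 * Real.exp (-2 * s ^ 2 - 4 * u)) := fun k => by
    rw [opNorm_smul, abs_of_pos (by positivity)]
    gcongr
    exact hθ k
  have hd : 0 < d := Nat.cast_pos.1 h.d_pos
  have hr : L * ((l / 2)⁻¹ * (1 / L * (1 / 64 * Real.exp (-2 * s ^ 2 - 4 * u))) * (2 * U))
      ≤ 1 / 16 := by
    have e : L * ((l / 2)⁻¹ * (1 / L * (1 / 64 * Real.exp (-2 * s ^ 2 - 4 * u))) * (2 * U))
        = 1 / 16 * (l⁻¹ * Real.exp (-2 * s ^ 2 - 4 * u) * U) := by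
      field_simp
      norm_num
    rw [e, hl, hU, ← Real.exp_neg, ← Real.exp_add, ← Real.exp_add]
    have : Real.exp (-(-(2 * s ^ 2 / (d : ℝ)) - u) + (-2 * s ^ 2 - 4 * u) + (s ^ 2 / 2 + u)) ≤ 1 :=
      Real.exp_le_one_iff.2 (by nlinarith [h.two_mul_sq_div_le, h.u_pos, sq_nonneg s])
    linarith
  have hmain := partialProduct_add_bounds (half_pos hl0) ha hb hR hr hd k.succ
  change opNorm (partialProduct (fun j => A j + (1 / (L : ℝ)) • θ j) k.succ) ≤ _ ∧
    _ ≤ sigmaMin (partialProduct (fun j => A j + (1 / (L : ℝ)) • θ j) k.succ)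
  exact ⟨hmain.1.trans (by linarith), le_trans (by linarith) hmain.2⟩

/-- The exceptional set is a finite union over the net, hence measurable, whereas the event in the
theorem quantifies over all perturbations. -/
lemma exists_measurableSet_bounds (h : Admissible s L d u) :
    ∃ B : Set (Fin L → Fin d → Fin d → ℝ), MeasurableSet B ∧
      (Measure.pi fun _ : Fin L => gaussianMatrix d) B
        ≤ ENNReal.ofReal (8 * Real.exp (-(d * u ^ 2 / (32 * s ^ 2)))) ∧
      ∀ x ∉ B, ∀ θ : Fin L → Matrix (Fin d) (Fin d) ℝ,
        (∀ k, opNorm (θ k) ≤ 1 / 64 * Real.exp (-2 * s ^ 2 - 4 * u)) → ∀ k : Fin L,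
          opNorm (partialProduct (residualWeight s (fun j => Matrix.of (x j)) θ) k.succ)
              ≤ 4 * Real.exp (s ^ 2 / 2 + u) ∧
            1 / 4 * Real.exp (-(2 * s ^ 2 / (d : ℝ)) - u)
              ≤ sigmaMin
                (partialProduct (residualWeight s (fun j => Matrix.of (x j)) θ) k.succ) := by
  have hm : 0 < mesh s d u := by unfold mesh; positivity
  obtain ⟨S, hS1, hS, hcard⟩ := exists_finset_sphere_net (E := EuclideanSpace ℝ (Fin d))
    hm (by linarith [h.mesh_le])
  rw [finrank_euclideanSpace_fin] at hcard
  let bad : EuclideanSpace ℝ (Fin d) → Set (Fin L → Fin d → Fin d → ℝ) := fun w =>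
    {x | HitsWithin (residualStep (s / √((L : ℝ) * d)))
      {z | Real.exp (s ^ 2 / 2 + u) ≤ ‖z‖} L x w} ∪
    {x | HitsWithin (residualStep (s / √((L : ℝ) * d)))
      {z | ‖z‖ ≤ Real.exp (-(2 * s ^ 2 / d) - u)} L x w}
  have hmeas : ∀ B : Set (EuclideanSpace ℝ (Fin d)), MeasurableSet B → ∀ w,
      MeasurableSet {x | HitsWithin (residualStep (s / √((L : ℝ) * d))) B L x w} := fun B hB w =>
    (measurable_id.prodMk measurable_const) (measurableSet_hitsWithin measurable_residualStep hB L)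
  have hbad : ∀ w ∈ S, (Measure.pi fun _ : Fin L => gaussianMatrix d) (bad w)
      ≤ ENNReal.ofReal (3 * Real.exp (-(d * u ^ 2 / (8 * s ^ 2)))) := fun w hw => by
    refine (measure_union_le _ _).trans ((add_le_add (h.measure_exists_norm_ge (hS1 w hw))
      (h.measure_exists_norm_le (hS1 w hw))).trans (le_of_eq ?_))
    rw [← ENNReal.ofReal_add (by positivity) (by positivity)]
    congr 1
    ring
  refine ⟨⋃ w ∈ S, bad w, ?_, ?_, ?_⟩
  · exact S.measurableSet_biUnion fun w _ =>
      (hmeas _ (measurableSet_le measurable_const measurable_norm) w).union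
        (hmeas _ (measurableSet_le measurable_norm measurable_const) w)
  · calc _ ≤ ∑ w ∈ S, (Measure.pi fun _ : Fin L => gaussianMatrix d) (bad w) :=
          measure_biUnion_finset_le S bad
      _ ≤ ∑ w ∈ S, ENNReal.ofReal (3 * Real.exp (-(d * u ^ 2 / (8 * s ^ 2)))) :=
          Finset.sum_le_sum hbad
      _ = ENNReal.ofReal (S.card * (3 * Real.exp (-(d * u ^ 2 / (8 * s ^ 2))))) := by
          rw [Finset.sum_const, nsmul_eq_mul, ENNReal.ofReal_mul (Nat.cast_nonneg _),
            ENNReal.ofReal_natCast]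
      _ ≤ _ := by
          refine ENNReal.ofReal_le_ofReal (le_trans ?_ h.net_card_mul_le)
          gcongr
  · intro x hx θ hθ k
    simp only [Set.mem_iUnion, not_exists] at hx
    exact h.bounds_of_net hS (fun w hw hh => hx w hw (Or.inl hh))
      (fun w hw hh => hx w hw (Or.inr hh)) θ hθ k

end Admissible

end

theorem lemma3 (s : ℝ) (hs : 0 < s) :
    ∃ C₁ C₂ C₃ C₄ : ℝ, 0 < C₁ ∧ 0 < C₂ ∧ 0 < C₃ ∧ 0 < C₄ ∧
      ∀ (L d : ℕ) (u : ℝ), C₁ ≤ (L : ℝ) → C₂ ≤ (d : ℝ) →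
        u ∈ Set.Icc C₃ (C₄ * (L : ℝ) ^ (1 / 4 : ℝ)) →
        ∀ {Ω : Type*} [MeasurableSpace Ω] (P : Measure Ω) [IsProbabilityMeasure P]
          (N : Fin L → Ω → Matrix (Fin d) (Fin d) ℝ), IsIIDStdGaussian P N →
          1 - 8 * Real.exp (-((d : ℝ) * u ^ 2 / (32 * s ^ 2))) ≤
            P.real {ω | ∀ θ : Fin L → Matrix (Fin d) (Fin d) ℝ,
              (∀ k, opNorm (θ k) ≤ 1 / 64 * Real.exp (-2 * s ^ 2 - 4 * u)) →
              ∀ k : Fin L,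
                opNorm (partialProduct (residualWeight s (fun j => N j ω) θ) k.succ)
                    ≤ 4 * Real.exp (s ^ 2 / 2 + u) ∧
                1 / 4 * Real.exp (-(2 * s ^ 2 / (d : ℝ)) - u)
                    ≤ sigmaMin
                        (partialProduct (residualWeight s (fun j => N j ω) θ) k.succ)} := by
  refine ⟨(16 * s ^ 2 + 2) ^ 2, 2, 1 + 64 * s ^ 2, 1, by positivity, by norm_num, by positivity,
    one_pos, ?_⟩
  intro L d u hL hd hu Ω _ P _ N hN
  have hadm : Admissible s L d u := by
    refine ⟨hs, hd, hu.1, ?_, Real.le_sqrt_of_sq_le hL⟩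
    have hu0 : 0 ≤ u := le_trans (by positivity) hu.1
    calc u ^ 2 ≤ ((L : ℝ) ^ (1 / 4 : ℝ)) ^ 2 := by
          gcongr
          simpa using hu.2
      _ = √L := by
          rw [← Real.rpow_natCast, ← Real.rpow_mul (Nat.cast_nonneg _), Real.sqrt_eq_rpow]
          norm_num
  obtain ⟨B, hBm, hB, hgood⟩ := hadm.exists_measurableSet_bounds
  have hBreal : (Measure.pi fun _ : Fin L => gaussianMatrix d).real B
      ≤ 8 * Real.exp (-(d * u ^ 2 / (32 * s ^ 2))) :=
    ENNReal.toReal_le_of_le_ofReal (by positivity) hB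
  calc _ ≤ (Measure.pi fun _ : Fin L => gaussianMatrix d).real Bᶜ := by
        rw [probReal_compl_eq_one_sub hBm]
        linarith
    _ = P.real ((fun ω k i j => N k ω i j) ⁻¹' Bᶜ) := by
        rw [← hN.map_eq, map_measureReal_apply_of_aemeasurable hN.aemeasurable hBm.compl]
    _ ≤ _ := measureReal_mono fun ω hω => hgood _ hω
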